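/- Let $\Omega\subseteq\mathbb{R}^N$ be a bounded open set, $1<p<\infty$, $p'=\frac{p}{p-1}$, let $W^{1,p}_0(\Omega)$ be the closure of $C^\infty_c(\Omega)$ in the Sobolev norm and $W^{-1,p'}(\Omega)$ its topological dual. For $u\in W^{1,p}_0(\Omega)$ let $-\Delta_p u\in W^{-1,p'}(\Omega)$ be given by $\langle -\Delta_p u,v\rangle=\int_\Omega|\nabla u|^{p-2}\nabla u\cdot\nabla v\,dx$. Let $\phi:\Omega\to\mathbb{R}$ be Lebesgue measurable with $\phi_+:=\max\{\phi,0\}\in W^{1,p}_0(\Omega)$, and set $$K:=\{v\in W^{1,p}_0(\Omega):\ v\ge\phi\ \text{a.e. in }\Omega\}.$$ Let $\eta\in W^{-1,p'}(\Omega)$ and let $u\in K$ satisfy $$\int_\Omega|\nabla u|^{p-2}\nabla u\cdot\nabla(v-u)\,dx\ \ge\ \langle\eta,v-u\rangle\qquad\text{for all }v\in K.$$ Then $\eta\le-\Delta_p u$ in $W^{-1,p'}(\Omega)$, that is, $\langle\eta,v\rangle\le\langle-\Delta_p u,v\rangle$ for all $v\in W^{1,p}_0(\Omega)$ with $v\ge0$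 a.e. If moreover $u\ge0$ a.e. in $\Omega$, then also $-\Delta_p u\le\max\{-\Delta_p\phi_+,\eta\}$, that is, for all $v\in W^{1,p}_0(\Omega)$ with $v\ge 0$ a.e., $$\langle-\Delta_p u,v\rangle\ \le\ \max\{-\Delta_p\phi_+,\eta\}(v):=\sup_{\substack{z\in W^{1,p}_0(\Omega)\\ 0\le z\le v}}\Big(\langle-\Delta_p\phi_+,z\rangle+\langle\eta,v-z\rangle\Big)\in(-\infty,+\infty]$$ (the Riesz–Kantorovich formula). -/

import Mathlib

open MeasureTheory Set
open scoped ENNReal ContDiff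

noncomputable section

namespace Obstacle

-- For `1 < p` the exponent `p`, seen in `[0, ∞]`, is at least `1`, so that `Lᵖ` is normed.
instance fact_one_le_ofReal (p : ℝ) [hp : Fact (1 < p)] : Fact (1 ≤ ENNReal.ofReal p) :=
  ⟨by simpa using hp.out.le⟩

/-- `Lᵖ(Ω; F)` with respect to Lebesgue measure on `Ω ⊆ ℝᴺ`. -/
abbrev LpOn {N : ℕ} (Ω : Set (EuclideanSpace ℝ (Fin N))) (p : ℝ)
    (F : Type*) [NormedAddCommGroup F] : Type _ :=
  Lp F (ENNReal.ofReal p) ((volume : Measure (EuclideanSpace ℝ (Fin N))).restrict Ω)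

/-- `φ ∈ C_c^∞(Ω)`: smooth, with compact support contained in `Ω`. -/
structure IsTestFunction {N : ℕ} (Ω : Set (EuclideanSpace ℝ (Fin N)))
    (φ : EuclideanSpace ℝ (Fin N) → ℝ) : Prop where
  contDiff : ContDiff ℝ ∞ φ
  hasCompactSupport : HasCompactSupport φ
  tsupport_subset : tsupport φ ⊆ Ω

/-- The graph `{(φ, ∇φ) : φ ∈ C_c^∞(Ω)}` in `Lᵖ(Ω) × Lᵖ(Ω; ℝᴺ)`. -/
def testGraph {N : ℕ} (Ω : Set (EuclideanSpace ℝ (Fin N))) (p : ℝ) :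
    Submodule ℝ (LpOn Ω p ℝ × LpOn Ω p (EuclideanSpace ℝ (Fin N))) where
  carrier := {w | ∃ φ : EuclideanSpace ℝ (Fin N) → ℝ, IsTestFunction Ω φ ∧
    (w.1 : EuclideanSpace ℝ (Fin N) → ℝ) =ᵐ[volume.restrict Ω] φ ∧
    (w.2 : EuclideanSpace ℝ (Fin N) → EuclideanSpace ℝ (Fin N))
      =ᵐ[volume.restrict Ω] gradient φ}
  zero_mem' := by
    refine ⟨fun _ => 0, ⟨contDiff_const, HasCompactSupport.zero, ?_⟩, ?_, ?_⟩
    · simp [tsupport, Function.support]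
    · exact Lp.coeFn_zero _ _ _
    · filter_upwards [Lp.coeFn_zero (EuclideanSpace ℝ (Fin N)) (ENNReal.ofReal p)
        (volume.restrict Ω)] with x hx
      simpa [gradient] using hx
  add_mem' := by
    rintro a b ⟨φ, hφ, h1, h2⟩ ⟨ψ, hψ, h3, h4⟩
    refine ⟨φ + ψ, ⟨hφ.contDiff.add hψ.contDiff,
      hφ.hasCompactSupport.add hψ.hasCompactSupport,
      (tsupport_add φ ψ).trans (union_subset hφ.tsupport_subset hψ.tsupport_subset)⟩, ?_, ?_⟩
    · filter_upwards [h1, h3, Lp.coeFn_add a.1 b.1] with x e1 e3 e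
      rw [Prod.fst_add, e, Pi.add_apply, Pi.add_apply, e1, e3]
    · filter_upwards [h2, h4, Lp.coeFn_add a.2 b.2] with x e2 e4 e
      rw [Prod.snd_add, e, Pi.add_apply, e2, e4]
      simp only [gradient]
      rw [fderiv_add (hφ.contDiff.differentiable (by simp)).differentiableAt
        (hψ.contDiff.differentiable (by simp)).differentiableAt, map_add]
  smul_mem' := by
    rintro c a ⟨φ, hφ, h1, h2⟩
    refine ⟨c • φ, ⟨hφ.contDiff.const_smul c, hφ.hasCompactSupport.smul_left (f := fun _ => c),
      (tsupport_smul_subset_right (fun _ => c) φ).trans hφ.tsupport_subset⟩, ?_, ?_⟩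
    · filter_upwards [h1, Lp.coeFn_smul c a.1] with x e1 e
      rw [Prod.smul_fst, e, Pi.smul_apply, Pi.smul_apply, e1]
    · filter_upwards [h2, Lp.coeFn_smul c a.2] with x e2 e
      rw [Prod.smul_snd, e, Pi.smul_apply, e2]
      simp only [gradient]
      rw [fderiv_const_smul (hφ.contDiff.differentiable (by simp)).differentiableAt, map_smul]

/-- `W₀^{1,p}(Ω)`: the closure of `C_c^∞(Ω)` in the Sobolev norm. A function is stored together
with its weak gradient, so the closure is taken of the pairs `(φ, ∇φ)` in
`Lᵖ(Ω) × Lᵖ(Ω; ℝᴺ)`; the norm is `max (‖u‖_p) (‖∇u‖_p)`, which is equivalent to the standard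
Sobolev norm (and, for bounded `Ω`, to `‖∇u‖_p`). -/
def sobolevZero {N : ℕ} (Ω : Set (EuclideanSpace ℝ (Fin N))) (p : ℝ) [Fact (1 < p)] :
    Submodule ℝ (LpOn Ω p ℝ × LpOn Ω p (EuclideanSpace ℝ (Fin N))) :=
  (testGraph Ω p).topologicalClosure

/-- The normed space `W₀^{1,p}(Ω)`. -/
abbrev W10 {N : ℕ} (Ω : Set (EuclideanSpace ℝ (Fin N))) (p : ℝ) [Fact (1 < p)] : Type _ :=
  sobolevZero Ω p

/-- `W^{-1,p'}(Ω)`, the topological dual of `W₀^{1,p}(Ω)`. -/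
abbrev WDual {N : ℕ} (Ω : Set (EuclideanSpace ℝ (Fin N))) (p : ℝ) [Fact (1 < p)] : Type _ :=
  StrongDual ℝ (W10 Ω p)

section

variable {N : ℕ} {Ω : Set (EuclideanSpace ℝ (Fin N))} {p : ℝ} [Fact (1 < p)]

/-- The function underlying an element of `W₀^{1,p}(Ω)`. -/
def W10.fn (u : W10 Ω p) : EuclideanSpace ℝ (Fin N) → ℝ :=
  ((u : LpOn Ω p ℝ × LpOn Ω p (EuclideanSpace ℝ (Fin N))).1 : EuclideanSpace ℝ (Fin N) → ℝ)

/-- The weak gradient of an element of `W₀^{1,p}(Ω)`. -/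
def W10.grad (u : W10 Ω p) : EuclideanSpace ℝ (Fin N) → EuclideanSpace ℝ (Fin N) :=
  ((u : LpOn Ω p ℝ × LpOn Ω p (EuclideanSpace ℝ (Fin N))).2 :
    EuclideanSpace ℝ (Fin N) → EuclideanSpace ℝ (Fin N))

/-- `u ≤ v` almost everywhere in `Ω`. -/
def W10.AeLe (u v : W10 Ω p) : Prop := u.fn ≤ᵐ[volume.restrict Ω] v.fn

/-- `|∇u|^{p-2} ∇u` -/
def W10.flux (u : W10 Ω p) (x : EuclideanSpace ℝ (Fin N)) : EuclideanSpace ℝ (Fin N) :=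
  ‖u.grad x‖ ^ (p - 2) • u.grad x

theorem W10.memLp_grad (u : W10 Ω p) :
    MemLp u.grad (ENNReal.ofReal p) (volume.restrict Ω) := Lp.memLp _

theorem W10.norm_flux (u : W10 Ω p) (x : EuclideanSpace ℝ (Fin N)) :
    ‖u.flux x‖ = ‖u.grad x‖ ^ (p - 1) := by
  have hp : 1 < p := Fact.out
  rw [W10.flux, norm_smul, Real.norm_of_nonneg (Real.rpow_nonneg (norm_nonneg _) _)]
  rcases eq_or_ne (‖u.grad x‖) 0 with h | h
  · rw [h, mul_zero, Real.zero_rpow (by linarith)]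
  · nth_rewrite 2 [← Real.rpow_one ‖u.grad x‖]
    rw [← Real.rpow_add (lt_of_le_of_ne (norm_nonneg _) h.symm)]
    congr 1; ring

theorem W10.memLp_flux (u : W10 Ω p) :
    MemLp u.flux (ENNReal.ofReal (p.conjExponent)) (volume.restrict Ω) := by
  have hp : 1 < p := Fact.out
  have h := u.memLp_grad.norm_rpow_div (ENNReal.ofReal (p - 1))
  rw [← ENNReal.ofReal_div_of_pos (by linarith), ENNReal.toReal_ofReal (by linarith)] at h
  refine MemLp.of_le h ?_ (Filter.Eventually.of_forall fun x => ?_)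
  · have hm := u.memLp_grad.aestronglyMeasurable
    exact (hm.norm.aemeasurable.pow_const (p - 2)).aestronglyMeasurable.smul hm
  · rw [u.norm_flux, Real.norm_of_nonneg (Real.rpow_nonneg (norm_nonneg _) _)]

theorem W10.integrable_flux (u v : W10 Ω p) :
    Integrable (fun x => inner ℝ (u.flux x) (v.grad x)) (volume.restrict Ω) := by
  have hp : 1 < p := Fact.out
  have hpq := (Real.HolderConjugate.conjExponent hp).symm
  have := hpq.ennrealOfReal
  refine Integrable.mono' (u.memLp_flux.norm.integrable_mul v.memLp_grad.norm) ?_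
    (Filter.Eventually.of_forall fun x => ?_)
  · exact u.memLp_flux.aestronglyMeasurable.inner v.memLp_grad.aestronglyMeasurable
  · exact norm_inner_le_norm _ _

theorem W10.abs_integral_flux_le (u v : W10 Ω p) :
    ‖∫ x in Ω, inner ℝ (u.flux x) (v.grad x)‖ ≤
      (∫ x in Ω, ‖u.flux x‖ ^ p.conjExponent) ^ (1 / p.conjExponent) * ‖v‖ := by
  have hp : 1 < p := Fact.out
  have hpq := (Real.HolderConjugate.conjExponent hp).symm
  have := hpq.ennrealOfReal
  have h1 : ‖∫ x in Ω, inner ℝ (u.flux x) (v.grad x)‖ ≤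
      ∫ x in Ω, ‖u.flux x‖ * ‖v.grad x‖ :=
    norm_integral_le_of_norm_le (u.memLp_flux.norm.integrable_mul v.memLp_grad.norm)
      (Filter.Eventually.of_forall fun x => norm_inner_le_norm _ _)
  have h2 := integral_mul_norm_le_Lp_mul_Lq hpq u.memLp_flux v.memLp_grad
  have h3 : (∫ x in Ω, ‖v.grad x‖ ^ p) ^ (1 / p) ≤ ‖v‖ := by
    have h4 : ‖v.1.2‖ = (∫ x in Ω, ‖v.grad x‖ ^ p) ^ (1 / p) := by
      have h5 := v.memLp_grad.eLpNorm_eq_integral_rpow_norm (by simpa using hp.trans' one_pos)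
        ENNReal.ofReal_ne_top
      rw [ENNReal.toReal_ofReal (by linarith), ← one_div] at h5
      rw [Lp.norm_def]
      refine (congrArg ENNReal.toReal h5).trans (ENNReal.toReal_ofReal ?_)
      positivity
    rw [← h4]
    exact norm_snd_le v.1
  refine h1.trans (h2.trans (mul_le_mul_of_nonneg_left h3 ?_))
  positivity

/-- `-Δ_p u ∈ W^{-1,p'}(Ω)`, i.e. `⟨-Δ_p u, v⟩ = ∫_Ω |∇u|^{p-2} ∇u · ∇v dx`. -/
def negPLaplacian (u : W10 Ω p) : WDual Ω p :=
  LinearMap.mkContinuous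
    { toFun := fun v => ∫ x in Ω, inner ℝ (u.flux x) (v.grad x)
      map_add' := fun v w => by
        rw [← integral_add (u.integrable_flux v) (u.integrable_flux w)]
        refine integral_congr_ae ?_
        filter_upwards [Lp.coeFn_add v.1.2 w.1.2] with x hx
        rw [← inner_add_right]
        exact congrArg _ hx
      map_smul' := fun c v => by
        rw [RingHom.id_apply, smul_eq_mul, ← integral_const_mul]
        refine integral_congr_ae ?_
        filter_upwards [Lp.coeFn_smul c v.1.2] with x hx
        rw [← real_inner_smul_right]
        exact congrArg _ hx }
    _ (fun v => u.abs_integral_flux_le v)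

theorem negPLaplacian_apply (u v : W10 Ω p) :
    negPLaplacian u v = ∫ x in Ω, inner ℝ (‖u.grad x‖ ^ (p - 2) • u.grad x) (v.grad x) := rfl

/-- `K = {u ∈ W₀^{1,p}(Ω) : u ≥ φ a.e. in Ω}` -/
def obstacleSet (Ω : Set (EuclideanSpace ℝ (Fin N))) (p : ℝ) [Fact (1 < p)]
    (φ : EuclideanSpace ℝ (Fin N) → ℝ) : Set (W10 Ω p) :=
  {u | φ ≤ᵐ[volume.restrict Ω] u.fn}

/-- The Riesz–Kantorovich maximum of two functionals, evaluated at `v ≥ 0`: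
`max{S, T}(v) = sup {⟨S, z⟩ + ⟨T, v - z⟩ : z ∈ W₀^{1,p}(Ω), 0 ≤ z ≤ v}`.
The supremum may be `+∞`, so it is taken in the extended reals. -/
def rkMax (S T : WDual Ω p) (v : W10 Ω p) : EReal :=
  ⨆ (z : W10 Ω p) (_ : W10.AeLe 0 z ∧ W10.AeLe z v), ((S z + T (v - z) : ℝ) : EReal)

end

end Obstacle

end

/-! The lower bound comes from the competitor `u + v`. For the upper bound write ψ = φ₊; since u ≥ φ
and u ≥ 0, ψ ≤ u. For t > 0 put w = (ψ - u + tv)⁺ and z = w/t, so that 0 ≤ z ≤ v. The function u -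
tv + w = max(u - tv, ψ) lies in K, and testing with it gives ⟨-Δ_p u, v - z⟩ ≤ ⟨η, v - z⟩. It
remains to replace u by ψ in ⟨-Δ_p u, z⟩. On {w > 0} one has ∇w = ∇ψ - ∇u + t∇v; monotonicity of a ↦
|a|^{p-2}a discards the part ∇ψ - ∇u, and division by t leaves the error ∫_{w>0} (|∇u|^{p-2}∇u -
|∇ψ|^{p-2}∇ψ)·∇v (`exists_truncation`). As t → 0 the indicator of {u - ψ < tv} tends to 0 where ψ <
u, while ∇u = ∇ψ a.e. where ψ = u, so the error vanishes by dominated convergence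
(`tendsto_truncation_error`).

Two Sobolev facts are needed, both derived from the definition by closure: positive parts stay in
the space with gradient χ_{u>0}∇u (`W10.exists_posPart`), and ∇u = 0 a.e. on {u = 0}
(`W10.grad_eq_zero_on_zeroSet`). -/

namespace Obstacle

open Filter Topology

/-! ### Dominated convergence and a smooth cutoff -/

/-- Dominated convergence in `Lᵖ` for products `hₙ • G` with `hₙ` uniformly bounded. -/
theorem tendsto_eLpNorm_smul_sub {α F : Type*} [MeasurableSpace α] {μ : Measure α}
    [NormedAddCommGroup F] [NormedSpace ℝ F] {p : ℝ} (hp : 0 < p) {C : ℝ}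
    {h : ℕ → α → ℝ} {k : α → ℝ} {G : α → F} (hG : MemLp G (ENNReal.ofReal p) μ)
    (hm : ∀ n, AEStronglyMeasurable (h n) μ) (hk : AEStronglyMeasurable k μ)
    (hC : ∀ n x, |h n x| ≤ C) (hkC : ∀ x, |k x| ≤ C)
    (hlim : ∀ᵐ x ∂μ, G x ≠ 0 → Tendsto (fun n => h n x) atTop (𝓝 (k x))) :
    Tendsto (fun n => eLpNorm (fun x => h n x • G x - k x • G x) (ENNReal.ofReal p) μ)
      atTop (𝓝 0) := by
  have hp0 : ENNReal.ofReal p ≠ 0 := by simpa using hp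
  have hpr : (ENNReal.ofReal p).toReal = p := ENNReal.toReal_ofReal hp.le
  simp only [eLpNorm_eq_lintegral_rpow_enorm_toReal hp0 ENNReal.ofReal_ne_top, hpr]
  have key : Tendsto (fun n => ∫⁻ x, ‖h n x • G x - k x • G x‖ₑ ^ p ∂μ) atTop (𝓝 0) := by
    have hb : MemLp (fun x => (2 * C) • G x) (ENNReal.ofReal p) μ := hG.const_smul (2 * C)
    have := tendsto_lintegral_of_dominated_convergence' (μ := μ)
      (F := fun n x => ‖h n x • G x - k x • G x‖ₑ ^ p) (f := fun _ => 0)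
      (fun x => ‖(2 * C) • G x‖ₑ ^ p)
      (fun n => ((((hm n).smul hG.1).sub (hk.smul hG.1)).enorm).pow_const p)
      (fun n => Eventually.of_forall fun x => ?_) ?_ ?_
    · simpa using this
    · dsimp only
      gcongr
      rw [← sub_smul, enorm_smul, enorm_smul]
      gcongr
      rw [enorm_le_iff_norm_le, Real.norm_eq_abs, Real.norm_eq_abs]
      have h1 := abs_sub (h n x) (k x)
      have h2 := le_abs_self (2 * C)
      linarith [hC n x, hkC x]
    · have := lintegral_rpow_enorm_lt_top_of_eLpNorm_lt_top hp0 ENNReal.ofReal_ne_top hb.2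
      rw [hpr] at this
      exact this.ne
    · filter_upwards [hlim] with x hx
      by_cases hGx : G x = 0
      · simp [hGx, hp]
      · have h1 : Tendsto (fun n => h n x • G x - k x • G x) atTop (𝓝 0) := by
          simpa using ((hx hGx).smul_const (G x)).sub_const (k x • G x)
        have h2 := (ENNReal.continuous_rpow_const (y := p)).tendsto _ |>.comp h1.enorm
        simpa [hp, Function.comp_def] using h2
  have := (ENNReal.continuous_rpow_const (y := 1 / p)).tendsto _ |>.comp key
  simpa [hp, Function.comp_def] using this

/-- The point is a global minimum, which also covers the endpoint `s = 0`. -/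
theorem deriv_smoothTransition_of_nonpos {s : ℝ} (hs : s ≤ 0) :
    deriv Real.smoothTransition s = 0 :=
  IsLocalMin.deriv_eq_zero <| Eventually.of_forall fun t => by
    rw [Real.smoothTransition.zero_of_nonpos hs]; exact Real.smoothTransition.nonneg t

theorem deriv_smoothTransition_of_one_le {s : ℝ} (hs : 1 ≤ s) :
    deriv Real.smoothTransition s = 0 :=
  IsLocalMax.deriv_eq_zero <| Eventually.of_forall fun t => by
    rw [Real.smoothTransition.one_of_one_le hs]; exact Real.smoothTransition.le_one t

theorem hasDerivAt_mul_smoothTransition (c s : ℝ) :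
    HasDerivAt (fun s => s * Real.smoothTransition (c * s))
      (Real.smoothTransition (c * s) + c * s * deriv Real.smoothTransition (c * s)) s := by
  have hd : Differentiable ℝ Real.smoothTransition :=
    (Real.smoothTransition.contDiff (n := 1)).differentiable (by simp)
  have h1 : HasDerivAt (fun s : ℝ => c * s) c s := by simpa using (hasDerivAt_id s).const_mul c
  have h2 := (hasDerivAt_id s).mul ((hd (c * s)).hasDerivAt.comp s h1)
  refine h2.congr_deriv ?_
  simp only [id, Function.comp_apply, one_mul]
  ring

/-- The derivative is supported in `[0, 1]`. Applied at `c * s`, the bound controls the derivative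
of `s * smoothTransition (c * s)` uniformly in `c`. -/
theorem exists_bound_mul_deriv_smoothTransition :
    ∃ M : ℝ, ∀ s : ℝ, |s * deriv Real.smoothTransition s| ≤ M := by
  have hc : Continuous fun s : ℝ => s * deriv Real.smoothTransition s :=
    continuous_id.mul ((Real.smoothTransition.contDiff (n := 1)).continuous_deriv (by simp))
  obtain ⟨M, hM⟩ := isCompact_Icc.exists_bound_of_continuousOn (s := Icc (0 : ℝ) 1) hc.continuousOn
  have hM0 : 0 ≤ M := (norm_nonneg _).trans (hM 0 (by simp))
  refine ⟨M, fun s => ?_⟩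
  rcases le_or_gt s 0 with h0 | h0
  · simpa [deriv_smoothTransition_of_nonpos h0] using hM0
  rcases le_or_gt 1 s with h1 | h1
  · simpa [deriv_smoothTransition_of_one_le h1] using hM0
  · exact hM s ⟨h0.le, h1.le⟩

section

variable {N : ℕ} {Ω : Set (EuclideanSpace ℝ (Fin N))} {p : ℝ} [Fact (1 < p)]

local notation "E" => EuclideanSpace ℝ (Fin N)

/-! ### Values, gradients and density of test functions -/

theorem W10.memLp_fn (u : W10 Ω p) :
    MemLp u.fn (ENNReal.ofReal p) (volume.restrict Ω) := Lp.memLp _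

theorem W10.fn_add (u v : W10 Ω p) :
    (u + v).fn =ᵐ[volume.restrict Ω] fun x => u.fn x + v.fn x := Lp.coeFn_add u.1.1 v.1.1

theorem W10.fn_sub (u v : W10 Ω p) :
    (u - v).fn =ᵐ[volume.restrict Ω] fun x => u.fn x - v.fn x := Lp.coeFn_sub u.1.1 v.1.1

theorem W10.fn_smul (c : ℝ) (u : W10 Ω p) :
    (c • u).fn =ᵐ[volume.restrict Ω] fun x => c * u.fn x := Lp.coeFn_smul c u.1.1

theorem W10.fn_zero : (0 : W10 Ω p).fn =ᵐ[volume.restrict Ω] fun _ => 0 := Lp.coeFn_zero _ _ _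

theorem W10.grad_add (u v : W10 Ω p) :
    (u + v).grad =ᵐ[volume.restrict Ω] fun x => u.grad x + v.grad x := Lp.coeFn_add u.1.2 v.1.2

theorem W10.grad_sub (u v : W10 Ω p) :
    (u - v).grad =ᵐ[volume.restrict Ω] fun x => u.grad x - v.grad x := Lp.coeFn_sub u.1.2 v.1.2

theorem W10.grad_smul (c : ℝ) (u : W10 Ω p) :
    (c • u).grad =ᵐ[volume.restrict Ω] fun x => c • u.grad x := Lp.coeFn_smul c u.1.2

/-- `W₀^{1,p}(Ω)` is closed under simultaneous `Lᵖ` limits of functions and gradients. -/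
theorem W10.exists_of_tendsto (w : ℕ → W10 Ω p) {f : E → ℝ} {G : E → E}
    (hf : MemLp f (ENNReal.ofReal p) (volume.restrict Ω))
    (hG : MemLp G (ENNReal.ofReal p) (volume.restrict Ω))
    (hwf : Tendsto (fun n => eLpNorm (fun x => (w n).fn x - f x) (ENNReal.ofReal p)
      (volume.restrict Ω)) atTop (𝓝 0))
    (hwG : Tendsto (fun n => eLpNorm (fun x => (w n).grad x - G x) (ENNReal.ofReal p)
      (volume.restrict Ω)) atTop (𝓝 0)) :
    ∃ v : W10 Ω p, v.fn =ᵐ[volume.restrict Ω] f ∧ v.grad =ᵐ[volume.restrict Ω] G := by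
  have h1 : Tendsto (fun n => (w n).1.1) atTop (𝓝 (hf.toLp f)) :=
    (Lp.tendsto_Lp_iff_tendsto_eLpNorm _ _ hf).2 hwf
  have h2 : Tendsto (fun n => (w n).1.2) atTop (𝓝 (hG.toLp G)) :=
    (Lp.tendsto_Lp_iff_tendsto_eLpNorm _ _ hG).2 hwG
  have h3 : ((hf.toLp f, hG.toLp G) : LpOn Ω p ℝ × LpOn Ω p E) ∈ sobolevZero Ω p :=
    (testGraph Ω p).isClosed_topologicalClosure.mem_of_tendsto (h1.prodMk_nhds h2)
      (Eventually.of_forall fun n => (w n).2)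
  exact ⟨⟨_, h3⟩, hf.coeFn_toLp, hG.coeFn_toLp⟩

theorem IsTestFunction.memLp {φ : E → ℝ} (hφ : IsTestFunction Ω φ) (q : ℝ≥0∞) :
    MemLp φ q (volume.restrict Ω) :=
  (hφ.contDiff.continuous.memLp_of_hasCompactSupport hφ.hasCompactSupport).restrict _

theorem IsTestFunction.continuous_gradient {φ : E → ℝ} (hφ : IsTestFunction Ω φ) :
    Continuous (gradient φ) :=
  (InnerProductSpace.toDual ℝ E).symm.continuous.comp (hφ.contDiff.continuous_fderiv (by simp))

theorem IsTestFunction.hasCompactSupport_gradient {φ : E → ℝ} (hφ : IsTestFunction Ω φ) :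
    HasCompactSupport (gradient φ) :=
  (hφ.hasCompactSupport.fderiv (𝕜 := ℝ)).comp_left
    (g := (InnerProductSpace.toDual ℝ E).symm) (map_zero _)

theorem IsTestFunction.memLp_gradient {φ : E → ℝ} (hφ : IsTestFunction Ω φ) (q : ℝ≥0∞) :
    MemLp (gradient φ) q (volume.restrict Ω) :=
  (hφ.continuous_gradient.memLp_of_hasCompactSupport hφ.hasCompactSupport_gradient).restrict _

/-- A test function belongs to `W₀^{1,p}(Ω)`. -/
theorem IsTestFunction.exists_W10 {φ : E → ℝ} (hφ : IsTestFunction Ω φ) :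
    ∃ v : W10 Ω p, v.fn =ᵐ[volume.restrict Ω] φ ∧ v.grad =ᵐ[volume.restrict Ω] gradient φ :=
  ⟨⟨((hφ.memLp _).toLp φ, (hφ.memLp_gradient _).toLp _),
    (testGraph Ω p).le_topologicalClosure
      ⟨φ, hφ, (hφ.memLp _).coeFn_toLp, (hφ.memLp_gradient _).coeFn_toLp⟩⟩,
    (hφ.memLp _).coeFn_toLp, (hφ.memLp_gradient _).coeFn_toLp⟩

/-- Density of test functions, along a sequence with almost everywhere convergence of values. -/
theorem W10.exists_seq_testFunction (u : W10 Ω p) :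
    ∃ φ : ℕ → E → ℝ, (∀ n, IsTestFunction Ω (φ n)) ∧
      Tendsto (fun n => eLpNorm (fun x => φ n x - u.fn x) (ENNReal.ofReal p)
        (volume.restrict Ω)) atTop (𝓝 0) ∧
      Tendsto (fun n => eLpNorm (fun x => gradient (φ n) x - u.grad x) (ENNReal.ofReal p)
        (volume.restrict Ω)) atTop (𝓝 0) ∧
      ∀ᵐ x ∂(volume.restrict Ω), Tendsto (fun n => φ n x) atTop (𝓝 (u.fn x)) := by
  have hu : u.1 ∈ closure (testGraph Ω p : Set (LpOn Ω p ℝ × LpOn Ω p E)) := u.2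
  obtain ⟨w, hw, hlim⟩ := mem_closure_iff_seq_limit.1 hu
  choose φ hφ h1 h2 using hw
  have l1 : Tendsto (fun n => (w n).1) atTop (𝓝 u.1.1) := (continuous_fst.tendsto _).comp hlim
  have l2 : Tendsto (fun n => (w n).2) atTop (𝓝 u.1.2) := (continuous_snd.tendsto _).comp hlim
  -- `Lᵖ` convergence gives convergence in measure, hence a subsequence converging a.e.
  obtain ⟨ns, hns, hae⟩ := (tendstoInMeasure_of_tendsto_Lp l1).exists_seq_tendsto_ae
  have e1 := ((Lp.tendsto_Lp_iff_tendsto_eLpNorm' _ _).1 l1).comp hns.tendsto_atTop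
  have e2 := ((Lp.tendsto_Lp_iff_tendsto_eLpNorm' _ _).1 l2).comp hns.tendsto_atTop
  refine ⟨fun n => φ (ns n), fun n => hφ _, e1.congr fun n => ?_, e2.congr fun n => ?_, ?_⟩
  · refine eLpNorm_congr_ae ?_
    filter_upwards [h1 (ns n)] with x hx
    simp [hx, W10.fn]
  · refine eLpNorm_congr_ae ?_
    filter_upwards [h2 (ns n)] with x hx
    simp [hx, W10.grad]
  · filter_upwards [hae, ae_all_iff.2 h1] with x hx hx1
    exact hx.congr fun n => hx1 _

/-! ### Chain rule and positive part -/

/-- Chain rule in `W₀^{1,p}(Ω)` for smooth functions with bounded derivative. -/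
theorem W10.exists_comp (u : W10 Ω p) {β : ℝ → ℝ} (hβ : ContDiff ℝ ∞ β) (hβ0 : β 0 = 0)
    {C : ℝ} (hC : ∀ s, |deriv β s| ≤ C) :
    ∃ v : W10 Ω p, v.fn =ᵐ[volume.restrict Ω] (fun x => β (u.fn x)) ∧
      v.grad =ᵐ[volume.restrict Ω] fun x => deriv β (u.fn x) • u.grad x := by
  have hp : 1 < p := Fact.out
  have hp1 : 1 ≤ ENNReal.ofReal p := Fact.out
  have hβd : Differentiable ℝ β := hβ.differentiable (by simp)
  have hβ' : Continuous (deriv β) := hβ.continuous_deriv (by simp)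
  have hlip : ∀ s t, ‖β s - β t‖ ≤ C * ‖s - t‖ := fun s t =>
    convex_univ.norm_image_sub_le_of_norm_deriv_le (fun x _ => hβd x) (fun x _ => hC x)
      (mem_univ t) (mem_univ s)
  obtain ⟨φ, hφ, l1, l2, hae⟩ := u.exists_seq_testFunction
  have hgrad : ∀ n x, gradient (β ∘ φ n) x = deriv β (φ n x) • gradient (φ n) x := by
    intro n x
    have hd : DifferentiableAt ℝ (φ n) x := (hφ n).contDiff.differentiable (by simp) x
    have := (hβd (φ n x)).hasDerivAt.comp_hasFDerivAt x hd.hasFDerivAt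
    simp only [gradient, this.fderiv, map_smul]
  have htest : ∀ n, IsTestFunction Ω (β ∘ φ n) := fun n =>
    ⟨hβ.comp (hφ n).contDiff, (hφ n).hasCompactSupport.comp_left hβ0,
      (closure_mono (Function.support_comp_subset hβ0 _)).trans (hφ n).tsupport_subset⟩
  choose w hw1 hw2 using fun n => (htest n).exists_W10 (p := p)
  have mu := u.memLp_fn
  have mg := u.memLp_grad
  have mβ' : AEStronglyMeasurable (fun x => deriv β (u.fn x)) (volume.restrict Ω) :=
    hβ'.comp_aestronglyMeasurable mu.1
  refine W10.exists_of_tendsto w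
    (mu.of_le_mul (c := C) (hβ.continuous.comp_aestronglyMeasurable mu.1)
      (Eventually.of_forall fun x => by simpa [hβ0] using hlip (u.fn x) 0))
    (mg.of_le_mul (c := C) (mβ'.smul mg.1) (Eventually.of_forall fun x => by
      rw [norm_smul]; gcongr; exact hC _)) ?_ ?_
  · refine tendsto_of_tendsto_of_tendsto_of_le_of_le tendsto_const_nhds
      (h := fun n => ENNReal.ofReal C * eLpNorm (fun x => φ n x - u.fn x) (ENNReal.ofReal p)
        (volume.restrict Ω)) ?_ (fun _ => zero_le) fun n => ?_
    · simpa using ENNReal.Tendsto.const_mul l1 (Or.inr ENNReal.ofReal_ne_top)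
    · refine eLpNorm_le_mul_eLpNorm_of_ae_le_mul ?_ _
      filter_upwards [hw1 n] with x hx
      rw [hx]
      exact hlip _ _
  -- Split β'(φₙ)∇φₙ - β'(u)∇u as β'(φₙ)(∇φₙ - ∇u) + (β'(φₙ) - β'(u))∇u: the first term is
  -- controlled by `C`, the second by dominated convergence.
  · have l3 := tendsto_eLpNorm_smul_sub (by linarith) mg (C := C)
      (h := fun n x => deriv β (φ n x)) (k := fun x => deriv β (u.fn x))
      (fun n => (hβ'.comp (hφ n).contDiff.continuous).aestronglyMeasurable) mβ'
      (fun n x => hC _) (fun x => hC _)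
      (hae.mono fun x hx _ => (hβ'.tendsto _).comp hx)
    refine tendsto_of_tendsto_of_tendsto_of_le_of_le tendsto_const_nhds
      (h := fun n => ENNReal.ofReal C * eLpNorm (fun x => gradient (φ n) x - u.grad x)
        (ENNReal.ofReal p) (volume.restrict Ω) + eLpNorm (fun x => deriv β (φ n x) • u.grad x -
          deriv β (u.fn x) • u.grad x) (ENNReal.ofReal p) (volume.restrict Ω)) ?_
      (fun _ => zero_le) fun n => ?_
    · simpa using (ENNReal.Tendsto.const_mul l2 (Or.inr ENNReal.ofReal_ne_top)).add l3
    · have m1 : AEStronglyMeasurable (fun x => deriv β (φ n x)) (volume.restrict Ω) :=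
        (hβ'.comp (hφ n).contDiff.continuous).aestronglyMeasurable
      have m2 : AEStronglyMeasurable (fun x => gradient (φ n) x - u.grad x) (volume.restrict Ω) :=
        (hφ n).continuous_gradient.aestronglyMeasurable.sub mg.1
      calc _ = eLpNorm ((fun x => deriv β (φ n x) • (gradient (φ n) x - u.grad x)) +
            fun x => deriv β (φ n x) • u.grad x - deriv β (u.fn x) • u.grad x)
            (ENNReal.ofReal p) (volume.restrict Ω) := by
            refine eLpNorm_congr_ae ?_
            filter_upwards [hw2 n] with x hx
            rw [hx, hgrad, Pi.add_apply, smul_sub]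
            abel
        _ ≤ _ := (eLpNorm_add_le (m1.smul m2) ((m1.smul mg.1).sub (mβ'.smul mg.1)) hp1).trans
            (add_le_add_left (eLpNorm_le_mul_eLpNorm_of_ae_le_mul
              (Eventually.of_forall fun x => by simp only [Pi.smul_apply', norm_smul]; gcongr; exact hC _) _) _)

/-- The positive part of an element of `W₀^{1,p}(Ω)` and its gradient. -/
theorem W10.exists_posPart (u : W10 Ω p) :
    ∃ v : W10 Ω p, v.fn =ᵐ[volume.restrict Ω] (fun x => max (u.fn x) 0) ∧
      v.grad =ᵐ[volume.restrict Ω]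
        fun x => (Ioi (0 : ℝ)).indicator (fun _ => (1 : ℝ)) (u.fn x) • u.grad x := by
  have hp : 1 < p := Fact.out
  obtain ⟨M, hM⟩ := exists_bound_mul_deriv_smoothTransition
  have hM0 : 0 ≤ M := (abs_nonneg _).trans (hM 0)
  have mu := u.memLp_fn
  have mg := u.memLp_grad
  have hst : ∀ s, |Real.smoothTransition s| ≤ 1 := fun s => by
    rw [abs_of_nonneg (Real.smoothTransition.nonneg s)]; exact Real.smoothTransition.le_one s
  have hbd : ∀ c s : ℝ,
      |Real.smoothTransition (c * s) + c * s * deriv Real.smoothTransition (c * s)| ≤ 1 + M :=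
    fun c s => (abs_add_le _ _).trans (add_le_add (hst _) (hM _))
  have hderiv : ∀ c s : ℝ, deriv (fun s => s * Real.smoothTransition (c * s)) s =
      Real.smoothTransition (c * s) + c * s * deriv Real.smoothTransition (c * s) :=
    fun c s => (hasDerivAt_mul_smoothTransition c s).deriv
  -- Smooth approximation of s⁺: it is 0 for s ≤ 0 and equals s for s ≥ 1/(n+1).
  have hex := fun n : ℕ => u.exists_comp
    (β := fun s => s * Real.smoothTransition (((n : ℝ) + 1) * s))
    (contDiff_id.mul (Real.smoothTransition.contDiff.comp (contDiff_const.mul contDiff_id)))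
    (by simp) (C := 1 + M) (fun s => by rw [hderiv]; exact hbd _ _)
  simp only [hderiv] at hex
  choose w hw1 hw2 using hex
  have hlarge : ∀ s : ℝ, 0 < s → ∀ᶠ n : ℕ in atTop, 1 ≤ ((n : ℝ) + 1) * s := by
    intro s hs
    have : Tendsto (fun n : ℕ => ((n : ℝ) + 1) * s) atTop atTop :=
      (tendsto_natCast_atTop_atTop.atTop_add tendsto_const_nhds).atTop_mul_const hs
    exact this.eventually_ge_atTop 1
  have hind : ∀ s : ℝ, |(Ioi (0 : ℝ)).indicator (fun _ => (1 : ℝ)) s| ≤ 1 := by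
    intro s; by_cases hs : 0 < s <;> simp [hs]
  have mind : AEStronglyMeasurable (fun x => (Ioi (0 : ℝ)).indicator (fun _ => (1 : ℝ)) (u.fn x))
      (volume.restrict Ω) :=
    ((measurable_const.indicator measurableSet_Ioi).comp_aemeasurable
      mu.1.aemeasurable).aestronglyMeasurable
  -- In this form the values, like the gradients, are bounded multipliers times a fixed `Lᵖ`
  -- function, so one convergence lemma serves both.
  have hmax : ∀ s : ℝ, max s 0 = (Ioi (0 : ℝ)).indicator (fun _ => (1 : ℝ)) s * s := by
    intro s
    by_cases hs : 0 < s
    · simp [hs, hs.le]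
    · simp [hs, not_lt.1 hs]
  have c0 : Continuous Real.smoothTransition := Real.smoothTransition.continuous
  have c1 : Continuous (deriv Real.smoothTransition) :=
    (Real.smoothTransition.contDiff (n := 1)).continuous_deriv (by simp)
  refine W10.exists_of_tendsto w ?_ ?_ ?_ ?_
  · refine mu.of_le ((continuous_id.max continuous_const).comp_aestronglyMeasurable mu.1)
      (Eventually.of_forall fun x => ?_)
    rw [hmax, norm_mul]
    exact mul_le_of_le_one_left (norm_nonneg _) (hind _)
  · refine mg.of_le (mind.smul mg.1) (Eventually.of_forall fun x => ?_)
    rw [norm_smul]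
    exact mul_le_of_le_one_left (norm_nonneg _) (hind _)
  · refine (tendsto_eLpNorm_smul_sub (by linarith) mu (C := 1)
      (h := fun n x => Real.smoothTransition (((n : ℝ) + 1) * u.fn x))
      (k := fun x => (Ioi (0 : ℝ)).indicator (fun _ => (1 : ℝ)) (u.fn x))
      (fun n => (by fun_prop : Continuous fun s : ℝ =>
        Real.smoothTransition (((n : ℝ) + 1) * s)).comp_aestronglyMeasurable mu.1) mind
      (fun n x => hst _) (fun x => hind _) (Eventually.of_forall fun x _ => ?_)).congr fun n => ?_
    · by_cases hs : 0 < u.fn x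
      · refine tendsto_const_nhds.congr' ?_
        filter_upwards [hlarge _ hs] with n hn
        simp [hs, Real.smoothTransition.one_of_one_le hn]
      · refine tendsto_const_nhds.congr fun n => ?_
        rw [Real.smoothTransition.zero_of_nonpos
          (mul_nonpos_of_nonneg_of_nonpos (by positivity) (not_lt.1 hs))]
        simp [hs]
    · refine eLpNorm_congr_ae ?_
      filter_upwards [hw1 n] with x hx
      rw [hx, hmax, smul_eq_mul, smul_eq_mul, mul_comm (u.fn x)]
  · refine (tendsto_eLpNorm_smul_sub (by linarith) mg (C := 1 + M)
      (h := fun n x => Real.smoothTransition (((n : ℝ) + 1) * u.fn x) +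
        ((n : ℝ) + 1) * u.fn x * deriv Real.smoothTransition (((n : ℝ) + 1) * u.fn x))
      (k := fun x => (Ioi (0 : ℝ)).indicator (fun _ => (1 : ℝ)) (u.fn x))
      (fun n => (by fun_prop : Continuous fun s : ℝ => Real.smoothTransition (((n : ℝ) + 1) * s) +
        ((n : ℝ) + 1) * s * deriv Real.smoothTransition
          (((n : ℝ) + 1) * s)).comp_aestronglyMeasurable mu.1) mind
      (fun n x => hbd _ _) (fun x => (hind _).trans (by linarith))
      (Eventually.of_forall fun x _ => ?_)).congr fun n => ?_
    · by_cases hs : 0 < u.fn x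
      · refine tendsto_const_nhds.congr' ?_
        filter_upwards [hlarge _ hs] with n hn
        simp [hs, Real.smoothTransition.one_of_one_le hn, deriv_smoothTransition_of_one_le hn]
      · refine tendsto_const_nhds.congr fun n => ?_
        have h0 : ((n : ℝ) + 1) * u.fn x ≤ 0 :=
          mul_nonpos_of_nonneg_of_nonpos (by positivity) (not_lt.1 hs)
        rw [Real.smoothTransition.zero_of_nonpos h0, deriv_smoothTransition_of_nonpos h0]
        simp [hs]
    · refine eLpNorm_congr_ae ?_
      filter_upwards [hw2 n] with x hx
      rw [hx]

/-! ### Uniqueness of the weak gradient and its vanishing on the zero set -/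

/-- Integration by parts for test functions. -/
theorem IsTestFunction.integral_mul_inner_gradient {φ ψ : E → ℝ} (hφ : IsTestFunction Ω φ)
    (hψ : IsTestFunction Ω ψ) (e : E) :
    (∫ x in Ω, inner ℝ (φ x) (inner ℝ (gradient ψ x) e)) +
      ∫ x in Ω, inner ℝ (gradient φ x) (ψ x • e) = 0 := by
  have hφd : Differentiable ℝ φ := hφ.contDiff.differentiable (by simp)
  have hψd : Differentiable ℝ ψ := hψ.contDiff.differentiable (by simp)
  have cφ := hφ.contDiff.continuous
  have cψ := hψ.contDiff.continuous
  have dφ : Continuous fun x => fderiv ℝ φ x e :=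
    (hφ.contDiff.continuous_fderiv (by simp)).clm_apply continuous_const
  have dψ : Continuous fun x => fderiv ℝ ψ x e :=
    (hψ.contDiff.continuous_fderiv (by simp)).clm_apply continuous_const
  have hψ0 : ∀ x, x ∉ Ω → ψ x = 0 := fun x hx =>
    image_eq_zero_of_notMem_tsupport fun h => hx (hψ.tsupport_subset h)
  have hφ0 : ∀ x, x ∉ Ω → φ x = 0 := fun x hx =>
    image_eq_zero_of_notMem_tsupport fun h => hx (hφ.tsupport_subset h)
  rw [setIntegral_eq_integral_of_forall_compl_eq_zero (fun x hx => by simp [hφ0 x hx]),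
    setIntegral_eq_integral_of_forall_compl_eq_zero (fun x hx => by simp [hψ0 x hx])]
  have key := integral_mul_fderiv_eq_neg_fderiv_mul_of_integrable (μ := (volume : Measure E))
    (f := φ) (g := ψ) (v := e)
    ((dφ.mul cψ).integrable_of_hasCompactSupport hψ.hasCompactSupport.mul_left)
    ((cφ.mul dψ).integrable_of_hasCompactSupport hφ.hasCompactSupport.mul_right)
    ((cφ.mul cψ).integrable_of_hasCompactSupport hφ.hasCompactSupport.mul_right)
    (fun x _ => hφd x) (fun x _ => hψd x)
  have e1 : ∀ x, inner ℝ (φ x) (inner ℝ (gradient ψ x) e) = φ x * fderiv ℝ ψ x e := fun x => by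
    rw [inner_gradient_left, mul_comm]; rfl
  have e2 : ∀ x, inner ℝ (gradient φ x) (ψ x • e) = fderiv ℝ φ x e * ψ x := fun x => by
    rw [inner_smul_right, inner_gradient_left, mul_comm]
  simp only [e1, e2]
  rw [key]
  ring

/-- Integration by parts in `W₀^{1,p}(Ω)` against a test function. -/
theorem W10.integral_mul_inner_gradient (u : W10 Ω p) {ψ : E → ℝ} (hψ : IsTestFunction Ω ψ)
    (e : E) :
    (∫ x in Ω, inner ℝ (u.fn x) (inner ℝ (gradient ψ x) e)) +
      ∫ x in Ω, inner ℝ (u.grad x) (ψ x • e) = 0 := by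
  have hp : 1 < p := Fact.out
  have := (Real.HolderConjugate.conjExponent hp).ennrealOfReal
  have : Fact (1 ≤ ENNReal.ofReal p.conjExponent) :=
    ⟨by simpa using (Real.HolderConjugate.conjExponent hp).symm.lt.le⟩
  have m1 : MemLp (fun x => inner ℝ (gradient ψ x) e) (ENNReal.ofReal p.conjExponent)
      (volume.restrict Ω) := (hψ.memLp_gradient _).inner_const e
  have m2 : MemLp (fun x => ψ x • e) (ENNReal.ofReal p.conjExponent) (volume.restrict Ω) :=
    (Continuous.memLp_of_hasCompactSupport (hψ.contDiff.continuous.smul continuous_const)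
      (hψ.hasCompactSupport.smul_right)).restrict _
  -- The identity says that a continuous functional vanishes; its kernel is closed, so it suffices
  -- that it contains the test graph.
  let L : LpOn Ω p ℝ × LpOn Ω p E →L[ℝ] ℝ :=
    (((innerSL ℝ : ℝ →L[ℝ] ℝ →L[ℝ] ℝ).lpPairing (volume.restrict Ω) (ENNReal.ofReal p)
      (ENNReal.ofReal p.conjExponent)).flip (m1.toLp _)).comp (ContinuousLinearMap.fst ℝ _ _) +
    (((innerSL ℝ : E →L[ℝ] E →L[ℝ] ℝ).lpPairing (volume.restrict Ω) (ENNReal.ofReal p)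
      (ENNReal.ofReal p.conjExponent)).flip (m2.toLp _)).comp (ContinuousLinearMap.snd ℝ _ _)
  have hL : ∀ w, L w = (∫ x in Ω, inner ℝ (w.1 x) (inner ℝ (gradient ψ x) e)) +
      ∫ x in Ω, inner ℝ (w.2 x) (ψ x • e) := by
    intro w
    simp only [L, add_apply, ContinuousLinearMap.comp_apply,
      ContinuousLinearMap.flip_apply, ContinuousLinearMap.coe_fst', ContinuousLinearMap.coe_snd',
      ContinuousLinearMap.lpPairing_eq_integral]
    congr 1
    · refine integral_congr_ae ?_
      filter_upwards [m1.coeFn_toLp] with x hx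
      rw [hx, innerSL_apply_apply ℝ]
    · refine integral_congr_ae ?_
      filter_upwards [m2.coeFn_toLp] with x hx
      rw [hx, innerSL_apply_apply ℝ]
  have hle : sobolevZero Ω p ≤ LinearMap.ker (L : LpOn Ω p ℝ × LpOn Ω p E →ₗ[ℝ] ℝ) := by
    refine Submodule.topologicalClosure_minimal _ ?_ L.isClosed_ker
    rintro w ⟨φ, hφ, h1, h2⟩
    rw [LinearMap.mem_ker]
    refine (hL w).trans ?_
    rw [← hφ.integral_mul_inner_gradient hψ e]
    congr 1
    · refine integral_congr_ae ?_
      filter_upwards [h1] with x hx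
      rw [hx]
    · refine integral_congr_ae ?_
      filter_upwards [h2] with x hx
      rw [hx]
  exact (hL u.1).symm.trans (LinearMap.mem_ker.1 (hle u.2))

/-- The weak gradient is determined by the function. -/
theorem W10.grad_eq_zero_of_fn_eq_zero (hΩ : IsOpen Ω) (u : W10 Ω p)
    (hu : u.fn =ᵐ[volume.restrict Ω] fun _ => 0) :
    u.grad =ᵐ[volume.restrict Ω] fun _ => 0 := by
  have hcoord : ∀ i, ∀ᵐ x ∂(volume.restrict Ω),
      inner ℝ (u.grad x) (EuclideanSpace.single i (1 : ℝ)) = 0 := by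
    intro i
    rw [ae_restrict_iff' hΩ.measurableSet]
    -- Fundamental lemma of the calculus of variations, one coordinate at a time.
    refine hΩ.ae_eq_zero_of_integral_contDiff_smul_eq_zero
      (locallyIntegrableOn_of_locallyIntegrable_restrict
        ((u.memLp_grad.inner_const _).locallyIntegrable Fact.out)) fun g hg hgc hgs => ?_
    have h := u.integral_mul_inner_gradient ⟨hg, hgc, hgs⟩ (EuclideanSpace.single i (1 : ℝ))
    rw [integral_eq_zero_of_ae (by filter_upwards [hu] with x hx; simp [hx]), zero_add] at h
    rw [← h, setIntegral_eq_integral_of_forall_compl_eq_zero fun x hx => ?_]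
    · simp only [inner_smul_right, smul_eq_mul]
    · rw [image_eq_zero_of_notMem_tsupport fun h => hx (hgs h)]
      simp
  filter_upwards [ae_all_iff.2 hcoord] with x hx
  ext i
  simpa [EuclideanSpace.inner_single_right] using hx i

/-- The gradient vanishes almost everywhere on the zero set. -/
theorem W10.grad_eq_zero_on_zeroSet (hΩ : IsOpen Ω) (u : W10 Ω p) :
    ∀ᵐ x ∂(volume.restrict Ω), u.fn x = 0 → u.grad x = 0 := by
  obtain ⟨v, hv1, hv2⟩ := u.exists_posPart
  obtain ⟨w, hw1, hw2⟩ := ((-1 : ℝ) • u).exists_posPart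
  -- u = u⁺ - (-u)⁺, and both positive parts have zero gradient on {u = 0} because the indicator of
  -- `Ioi 0` is 0 at 0.
  have h := (u - (v - w)).grad_eq_zero_of_fn_eq_zero hΩ (by
    filter_upwards [hv1, hw1, u.fn_sub (v - w), v.fn_sub w, u.fn_smul (-1)] with x h1 h2 h3 h4 h5
    rw [h3, h4, h1, h2, h5]
    rcases le_total (u.fn x) 0 with h | h
    · rw [max_eq_right h, max_eq_left (by linarith)]; ring
    · rw [max_eq_left h, max_eq_right (by linarith)]; ring)
  filter_upwards [h, hv2, hw2, u.grad_sub (v - w), v.grad_sub w, u.fn_smul (-1)]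
    with x h1 h2 h3 h4 h5 h6 h0
  rw [h4, h5, h2, h3, h6, h0] at h1
  simpa using h1

/-! ### Monotonicity, comparison and truncation -/

/-- Monotonicity of `a ↦ |a|^{p-2} a`. -/
theorem inner_rpow_smul_sub_nonneg {F : Type*} [NormedAddCommGroup F] [InnerProductSpace ℝ F]
    {p : ℝ} (hp : 1 < p) (a b : F) :
    0 ≤ inner ℝ (‖a‖ ^ (p - 2) • a - ‖b‖ ^ (p - 2) • b) (a - b) := by
  have hmul : ∀ r : ℝ, 0 ≤ r → r ^ (p - 2) * r = r ^ (p - 1) := by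
    intro r hr
    rcases hr.eq_or_lt with h | h
    · rw [← h, mul_zero, Real.zero_rpow (by linarith)]
    · rw [← Real.rpow_add_one h.ne']; congr 1; ring
  have ha := hmul _ (norm_nonneg a)
  have hb := hmul _ (norm_nonneg b)
  have hab := real_inner_le_norm a b
  have hpa : 0 ≤ ‖a‖ ^ (p - 2) := by positivity
  have hpb : 0 ≤ ‖b‖ ^ (p - 2) := by positivity
  -- By Cauchy–Schwarz this scalar product is a lower bound for the inner product in the goal.
  have hmono : 0 ≤ (‖a‖ ^ (p - 1) - ‖b‖ ^ (p - 1)) * (‖a‖ - ‖b‖) := by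
    rcases le_total ‖a‖ ‖b‖ with h | h
    · exact mul_nonneg_of_nonpos_of_nonpos
        (sub_nonpos.2 (Real.rpow_le_rpow (norm_nonneg _) h (by linarith))) (sub_nonpos.2 h)
    · exact mul_nonneg
        (sub_nonneg.2 (Real.rpow_le_rpow (norm_nonneg _) h (by linarith))) (sub_nonneg.2 h)
  rw [← ha, ← hb] at hmono
  simp only [inner_sub_left, inner_sub_right, real_inner_smul_left, real_inner_self_eq_norm_sq,
    real_inner_comm a b]
  nlinarith [mul_le_mul_of_nonneg_left hab hpa, mul_le_mul_of_nonneg_left hab hpb]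

/-- A solution of the obstacle problem is a supersolution. -/
theorem le_negPLaplacian_of_obstacle {φ : E → ℝ} {η : WDual Ω p} {u : W10 Ω p}
    (hu : u ∈ obstacleSet Ω p φ)
    (hsol : ∀ v ∈ obstacleSet Ω p φ, η (v - u) ≤ negPLaplacian u (v - u))
    {v : W10 Ω p} (hv : W10.AeLe 0 v) : η v ≤ negPLaplacian u v := by
  have h : u + v ∈ obstacleSet Ω p φ := by
    change _ ≤ᵐ[_] _
    filter_upwards [hu, hv, u.fn_add v, W10.fn_zero (Ω := Ω) (p := p)] with x h1 h2 h3 h4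
    rw [h3]
    rw [h4] at h2
    linarith
  simpa using hsol _ h

/-- Testing with the truncation `(ψ - u + t v)⁺ / t`: the error is an integral over the set
where `u - ψ < t v`. -/
theorem exists_truncation {φ : E → ℝ} {η : WDual Ω p} {u ψ v : W10 Ω p}
    (hsol : ∀ v ∈ obstacleSet Ω p φ, η (v - u) ≤ negPLaplacian u (v - u))
    (hφψ : φ ≤ᵐ[volume.restrict Ω] ψ.fn) (hψu : W10.AeLe ψ u) (hv : W10.AeLe 0 v)
    {t : ℝ} (ht : 0 < t) :
    ∃ z : W10 Ω p, W10.AeLe 0 z ∧ W10.AeLe z v ∧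
      negPLaplacian u v ≤ negPLaplacian ψ z + η (v - z) +
        ∫ x in Ω, (Ioi (0 : ℝ)).indicator (fun _ => (1 : ℝ)) (ψ.fn x - u.fn x + t * v.fn x) *
          inner ℝ (u.flux x - ψ.flux x) (v.grad x) := by
  have hp : 1 < p := Fact.out
  obtain ⟨w, hw1, hw2⟩ := (ψ - u + t • v).exists_posPart
  have hfn : (ψ - u + t • v).fn =ᵐ[volume.restrict Ω]
      fun x => ψ.fn x - u.fn x + t * v.fn x := by
    filter_upwards [(ψ - u).fn_add (t • v), ψ.fn_sub u, v.fn_smul t] with x h1 h2 h3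
    rw [h1, h2, h3]
  have hgr : (ψ - u + t • v).grad =ᵐ[volume.restrict Ω]
      fun x => ψ.grad x - u.grad x + t • v.grad x := by
    filter_upwards [(ψ - u).grad_add (t • v), ψ.grad_sub u, v.grad_smul t] with x h1 h2 h3
    rw [h1, h2, h3]
  have h0 := W10.fn_zero (Ω := Ω) (p := p)
  have hz0 : W10.AeLe 0 (t⁻¹ • w) := by
    filter_upwards [h0, w.fn_smul t⁻¹, hw1] with x h1 h2 h3
    rw [h1, h2, h3]
    positivity
  have hzv : W10.AeLe (t⁻¹ • w) v := by
    filter_upwards [h0, w.fn_smul t⁻¹, hw1, hfn, hψu, hv] with x h1 h2 h3 h4 h5 h6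
    rw [h2, h3, h4, inv_mul_le_iff₀ ht]
    rw [h1] at h6
    exact max_le (by linarith) (by positivity)
  refine ⟨t⁻¹ • w, hz0, hzv, ?_⟩
  -- This competitor is max(u - tv, ψ), which is at least ψ ≥ φ.
  have hmem : u - t • v + w ∈ obstacleSet Ω p φ := by
    change _ ≤ᵐ[_] _
    filter_upwards [(u - t • v).fn_add w, u.fn_sub (t • v), v.fn_smul t, hw1, hfn, hφψ]
      with x h1 h2 h3 h4 h5 h6
    rw [h1, h2, h3, h4, h5]
    have := le_max_left (ψ.fn x - u.fn x + t * v.fn x) 0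
    linarith
  have hcomp : negPLaplacian u (v - t⁻¹ • w) ≤ η (v - t⁻¹ • w) := by
    have h := hsol _ hmem
    -- The factor -t reverses the variational inequality.
    have e : u - t • v + w - u = (-t) • (v - t⁻¹ • w) := by
      rw [smul_sub, smul_smul, neg_mul, mul_inv_cancel₀ ht.ne']
      module
    rw [e, map_smul, map_smul, smul_eq_mul, smul_eq_mul] at h
    nlinarith
  set χ : E → ℝ := fun x =>
    (Ioi (0 : ℝ)).indicator (fun _ => (1 : ℝ)) (ψ.fn x - u.fn x + t * v.fn x) with hχ
  have hχ0 : ∀ x, 0 ≤ χ x := fun x => indicator_nonneg (fun _ _ => zero_le_one) _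
  have hχ1 : ∀ x, ‖χ x‖ ≤ 1 := fun x => by
    rw [Real.norm_of_nonneg (hχ0 x)]; exact indicator_le_self' (fun _ _ => zero_le_one) _
  have hχm : AEStronglyMeasurable χ (volume.restrict Ω) :=
    ((measurable_const.indicator measurableSet_Ioi).comp_aemeasurable
      (((ψ.memLp_fn.1.sub u.memLp_fn.1).add
        (v.memLp_fn.1.const_mul t)).aemeasurable)).aestronglyMeasurable
  have hint : Integrable (fun x => inner ℝ (u.flux x - ψ.flux x) (v.grad x))
      (volume.restrict Ω) := by
    simpa only [inner_sub_left] using! (u.integrable_flux v).sub (ψ.integrable_flux v)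
  have hdiff : negPLaplacian u w - negPLaplacian ψ w ≤
      t * ∫ x in Ω, χ x * inner ℝ (u.flux x - ψ.flux x) (v.grad x) := by
    have e : negPLaplacian u w - negPLaplacian ψ w =
        ∫ x in Ω, inner ℝ (u.flux x) (w.grad x) - inner ℝ (ψ.flux x) (w.grad x) :=
      (integral_sub (u.integrable_flux w) (ψ.integrable_flux w)).symm
    rw [e, ← integral_const_mul]
    refine integral_mono_ae ((u.integrable_flux w).sub (ψ.integrable_flux w))
      ((hint.bdd_mul hχm (Eventually.of_forall hχ1)).const_mul t) ?_
    filter_upwards [hw2, hfn, hgr] with x h1 h2 h3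
    have hmono := inner_rpow_smul_sub_nonneg hp (u.grad x) (ψ.grad x)
    change 0 ≤ inner ℝ (u.flux x - ψ.flux x) _ at hmono
    rw [h1, h2, h3, ← inner_sub_left, real_inner_smul_right, ← neg_sub (u.grad x), inner_add_right,
      inner_neg_right, real_inner_smul_right]
    -- The right side minus the left is `χ x` times the nonnegative quantity in `hmono`.
    change χ x * _ ≤ _
    nlinarith [mul_nonneg (hχ0 x) hmono]
  have hz : negPLaplacian u (t⁻¹ • w) - negPLaplacian ψ (t⁻¹ • w) ≤
      ∫ x in Ω, χ x * inner ℝ (u.flux x - ψ.flux x) (v.grad x) := by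
    rw [map_smul, map_smul, smul_eq_mul, smul_eq_mul, ← mul_sub, inv_mul_le_iff₀ ht]
    exact hdiff
  rw [map_sub] at hcomp
  linarith

/-- The error term of the truncation argument tends to zero. -/
theorem tendsto_truncation_error (hΩ : IsOpen Ω) {u ψ v : W10 Ω p} (hψu : W10.AeLe ψ u) :
    Tendsto (fun n : ℕ => ∫ x in Ω, (Ioi (0 : ℝ)).indicator (fun _ => (1 : ℝ))
        (ψ.fn x - u.fn x + 1 / ((n : ℝ) + 1) * v.fn x) *
          inner ℝ (u.flux x - ψ.flux x) (v.grad x)) atTop (𝓝 0) := by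
  have hint : Integrable (fun x => inner ℝ (u.flux x - ψ.flux x) (v.grad x))
      (volume.restrict Ω) := by
    simpa only [inner_sub_left] using! (u.integrable_flux v).sub (ψ.integrable_flux v)
  have h := tendsto_integral_of_dominated_convergence (μ := volume.restrict Ω)
    (F := fun (n : ℕ) x => (Ioi (0 : ℝ)).indicator (fun _ => (1 : ℝ))
        (ψ.fn x - u.fn x + 1 / ((n : ℝ) + 1) * v.fn x) *
          inner ℝ (u.flux x - ψ.flux x) (v.grad x)) (f := fun _ => 0)
    (fun x => ‖inner ℝ (u.flux x - ψ.flux x) (v.grad x)‖) (fun n => ?_) hint.norm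
    (fun n => Eventually.of_forall fun x => ?_) ?_
  · simpa using h
  · exact ((measurable_const.indicator measurableSet_Ioi).comp_aemeasurable
      (((ψ.memLp_fn.1.sub u.memLp_fn.1).add
        (v.memLp_fn.1.const_mul _)).aemeasurable)).aestronglyMeasurable.mul hint.1
  · rw [norm_mul]
    refine mul_le_of_le_one_left (norm_nonneg _) ?_
    rw [Real.norm_of_nonneg (indicator_nonneg (fun _ _ => zero_le_one) _)]
    exact indicator_le_self' (fun _ _ => zero_le_one) _
  · filter_upwards [(ψ - u).grad_eq_zero_on_zeroSet hΩ, ψ.fn_sub u, ψ.grad_sub u, hψu]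
      with x h1 h2 h3 h4
    rw [h2, h3] at h1
    -- On the contact set the indicator may stay 1, but the fluxes agree; off it the indicator is
    -- eventually 0.
    rcases h4.eq_or_lt with h | h
    · have hg : ψ.grad x = u.grad x := sub_eq_zero.1 (h1 (sub_eq_zero.2 h))
      have hf : ψ.flux x = u.flux x := by rw [W10.flux, W10.flux, hg]
      simp [hf]
    · have hl : Tendsto (fun n : ℕ => ψ.fn x - u.fn x + 1 / ((n : ℝ) + 1) * v.fn x) atTop
          (𝓝 (ψ.fn x - u.fn x)) := by
        simpa using (tendsto_one_div_add_atTop_nhds_zero_nat.mul_const (v.fn x)).const_add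
          (ψ.fn x - u.fn x)
      refine tendsto_const_nhds.congr' ?_
      filter_upwards [hl.eventually_lt_const (sub_neg.2 h)] with n hn
      rw [indicator_of_notMem (by simpa using hn.le), zero_mul]

end

end Obstacle

theorem mainTheorem6 {N : ℕ} (Ω : Set (EuclideanSpace ℝ (Fin N))) (hΩ_open : IsOpen Ω)
    (hΩ_bounded : Bornology.IsBounded Ω) (p : ℝ) [Fact (1 < p)]
    (φ : EuclideanSpace ℝ (Fin N) → ℝ) (hφ : AEMeasurable φ (volume.restrict Ω))
    (φplus : Obstacle.W10 Ω p)
    (hφplus : φplus.fn =ᵐ[volume.restrict Ω] fun x => max (φ x) 0)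
    (η : Obstacle.WDual Ω p) (u : Obstacle.W10 Ω p)
    (hu_mem : u ∈ Obstacle.obstacleSet Ω p φ)
    (hu_sol : ∀ v ∈ Obstacle.obstacleSet Ω p φ,
      η (v - u) ≤ Obstacle.negPLaplacian u (v - u)) :
    (∀ v : Obstacle.W10 Ω p, Obstacle.W10.AeLe 0 v → η v ≤ Obstacle.negPLaplacian u v) ∧
    (Obstacle.W10.AeLe 0 u → ∀ v : Obstacle.W10 Ω p, Obstacle.W10.AeLe 0 v →
      ((Obstacle.negPLaplacian u v : ℝ) : EReal) ≤
        Obstacle.rkMax (Obstacle.negPLaplacian φplus) η v) := by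
  refine ⟨fun v hv => Obstacle.le_negPLaplacian_of_obstacle hu_mem hu_sol hv, fun hu0 v hv => ?_⟩
  have hψu : Obstacle.W10.AeLe φplus u := by
    filter_upwards [hφplus, hu_mem, hu0, Obstacle.W10.fn_zero (Ω := Ω) (p := p)]
      with x h1 h2 h3 h4
    rw [h1]
    rw [h4] at h3
    exact max_le h2 h3
  have hφψ : φ ≤ᵐ[volume.restrict Ω] φplus.fn := by
    filter_upwards [hφplus] with x hx
    rw [hx]
    exact le_max_left _ _
  have herr := (Obstacle.tendsto_truncation_error hΩ_open (v := v) hψu).const_sub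
    (Obstacle.negPLaplacian u v)
  rw [sub_zero] at herr
  -- For each n, ⟨-Δ_p u, v⟩ minus the error is bounded by one term of the supremum, with t =
  -- 1/(n+1).
  refine le_of_tendsto ((continuous_coe_real_ereal.tendsto _).comp herr)
    (Filter.Eventually.of_forall fun n => ?_)
  obtain ⟨z, hz0, hzv, hz⟩ := Obstacle.exists_truncation hu_sol hφψ hψu hv
    (t := 1 / ((n : ℝ) + 1)) (by positivity)
  exact (EReal.coe_le_coe_iff.2 (sub_le_iff_le_add.2 hz)).trans
    (le_iSup₂_of_le z ⟨hz0, hzv⟩ le_rfl)
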